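/- Let $\mathbb{Q}(q)$ be the field of rational functions in an indeterminate $q$. For integers $m\ge 0$ put $[m]=\frac{1-q^m}{1-q}$ and $(q;q)_m=\prod_{i=1}^{m}(1-q^i)$, and let ${m\brack k}=\frac{(q;q)_m}{(q;q)_k(q;q)_{m-k}}$ for $0\le k\le m$ and ${m\brack k}=0$ otherwise. For $n\ge 1$ and $0\le k\le n$ put $$B_{n,k}(q)=\frac{[k]}{[n]}{2n\brack n-k},\qquad B_{n,k}=\frac{k}{n}\binom{2n}{n-k}.$$ Let $n$ be a positive integer, and let $a$ and $r$ be non-negative integers with $a\le n$. Then: 1. For every integer $j$ with $0\le j\le 2r+1$, the sum $$\sum_{k=a}^{n}(1+q^k)\,B_{n,k}(q)^{2r+1}\,q^{jk^2-(r+1)k}$$ is a Laurent polynomial in $q$ with integer coefficients, $(1+q^n){2n-1\brack n-a}$ is a polynomial in $q$ with integer coefficients, and the former is divisible by the latter in $\mathbb{Z}[q,q^{-1}]$. 2. (The case $q=1$.) The sum $\sum_{k=a}^{n}B_{n,k}^{2r+1}$ is an integer and $$\sum_{k=a}^{n}B_{n,k}^{2r+1}\equiv 0 \pmod{\binom{2n-1}{n-a}}.$$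 -/

import Mathlib

noncomputable section

open scoped Polynomial LaurentPolynomial

namespace QCatalan

/-- The indeterminate `q`, in the field `ℚ(q)` of rational functions. -/
abbrev q : RatFunc ℚ := RatFunc.X

/-- The `q`-integer `[n] = (1 - q ^ n) / (1 - q)`. -/
def qInt (n : ℕ) : RatFunc ℚ := (1 - q ^ n) / (1 - q)

/-- The `q`-shifted factorial `(x; q)_n = (1 - x) (1 - x q) ⋯ (1 - x q ^ (n - 1))`. -/
def qShifted (x : RatFunc ℚ) (n : ℕ) : RatFunc ℚ :=
  ∏ i ∈ Finset.range n, (1 - x * q ^ i)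

/-- The `q`-binomial coefficient `(q; q)_n / ((q; q)_k (q; q)_{n - k})` for `0 ≤ k ≤ n`, and `0`
otherwise. -/
def qBinom (n k : ℕ) : RatFunc ℚ :=
  if k ≤ n then qShifted q n / (qShifted q k * qShifted q (n - k)) else 0

/-- `B_{n,k}(q) = ([k] / [n]) * qBinom (2 n) (n - k)`, for `n ≥ 1` and `0 ≤ k ≤ n`. -/
def qB (n k : ℕ) : RatFunc ℚ := qInt k / qInt n * qBinom (2 * n) (n - k)

/-- The Catalan triangle numbers `B_{n,k} = (k / n) * C(2 n, n - k)`, for `n ≥ 1` and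
`0 ≤ k ≤ n`. -/
def B (n k : ℕ) : ℚ := (k : ℚ) / (n : ℚ) * ((2 * n).choose (n - k) : ℚ)

/-- The embedding of `ℤ[q, q⁻¹]` into `ℚ(q)` that sends the variable `T` to `q`. -/
def laurentToRatFunc : ℤ[T;T⁻¹] →+* RatFunc ℚ :=
  LaurentPolynomial.eval₂ (Int.castRingHom (RatFunc ℚ)) (Units.mk0 q RatFunc.X_ne_zero)

/-- `P ≡ 0 (mod D)`: `P` is a Laurent polynomial in `q`, `D` is a polynomial in `q` (both with
integer coefficients), and `D` divides `P` in `ℤ[q, q⁻¹]`. -/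
def LaurentDvd (D P : RatFunc ℚ) : Prop :=
  ∃ (d : ℤ[X]) (p : ℤ[T;T⁻¹]),
    laurentToRatFunc d.toLaurent = D ∧ laurentToRatFunc p = P ∧ d.toLaurent ∣ p

end QCatalan

end

open scoped Polynomial LaurentPolynomial

/-! Write (q)_m for (q;q)_m, P_n(k) = 1/((q)_{n-k} (q)_{n+k}) (`pairRecip`), E = (q)_{2n}/(1-q^n)
and κ = (1-q^k)^2/q^k (`kappa`). Then B_{n,k}(q) = E (1-q^k) P_n(k), and the summand is E^{2r+1}
(q^{-k} - q^k) κ^r q^{jk^2} P_n(k)^{2r+1}.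

By q-Vandermonde, both P_n(k) P_m(k) and q^{k^2} P_n(k) P_m(k) are combinations of the P_s(k) with s
≤ n, and κ P_s(k) involves only P_s(k) and P_{s-1}(k). Induction on r gives E^{2r} κ^r q^{ik^2}
P_n(k)^{2r+1} = Σ_s c_s P_s(k)/(q)_{n-s}^2 for 0 ≤ i ≤ 2r, where the c_s are integral Laurent
polynomials independent of k (`exists_coeff`); this integrality (`step_coeff_mem`) is the crux.

The remaining sum over k, which may carry one more factor q^{k^2}, telescopes (`sum_pairRecip`).
Together with (q)_{n-s}^{-2}, each boundary term is a product of two Gaussian binomials over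
(q)_{n-a} (q)_{n+a-1}, and E/((q)_{n-a} (q)_{n+a-1}) is exactly (1+q^n) times the Gaussian binomial
of 2n-1 over n-a. The case q = 1 follows by evaluating the Laurent polynomial identity at 1. -/

namespace QCatalan

/-! ### Reciprocal q-factorials and the q-Vandermonde identity. -/

section Generic

variable {K : Type*} [Field K]

/-- The reciprocal `1 / (q; q)_z`, which is zero for negative `z`. -/
noncomputable def invQFact (q : K) (z : ℤ) : K :=
  if 0 ≤ z then (∏ i ∈ Finset.range z.toNat, (1 - q ^ (i + 1)))⁻¹ else 0

theorem invQFact_of_neg (q : K) {z : ℤ} (hz : z < 0) : invQFact q z = 0 := by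
  simp [invQFact, not_le.mpr hz]

@[simp] theorem invQFact_zero (q : K) : invQFact q 0 = 1 := by simp [invQFact]

theorem invQFact_natCast (q : K) (n : ℕ) :
    invQFact q n = (∏ i ∈ Finset.range n, (1 - q ^ (i + 1)))⁻¹ := by
  simp [invQFact]

theorem one_sub_zpow_ne_zero {q : K} (hq : ∀ m : ℕ, 0 < m → q ^ m ≠ 1) {z : ℤ} (hz : 0 < z) :
    1 - q ^ z ≠ 0 := by
  lift z to ℕ using hz.le
  rw [zpow_natCast]
  exact sub_ne_zero.mpr (hq z (by exact_mod_cast hz)).symm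

theorem invQFact_ne_zero {q : K} (hq : ∀ m : ℕ, 0 < m → q ^ m ≠ 1) {z : ℤ} (hz : 0 ≤ z) :
    invQFact q z ≠ 0 := by
  lift z to ℕ using hz
  rw [invQFact_natCast]
  refine inv_ne_zero (Finset.prod_ne_zero_iff.mpr fun i _ => ?_)
  exact sub_ne_zero.mpr (hq (i + 1) i.succ_pos).symm

/-- Vanishing at negative integers makes the recurrence valid for every integer z; at z = 0 the
factor 1 - q^0 accounts for it. Later sums therefore need no boundary cases. -/
theorem invQFact_sub_one {q : K} (hq : ∀ m : ℕ, 0 < m → q ^ m ≠ 1) (z : ℤ) :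
    invQFact q (z - 1) = (1 - q ^ z) * invQFact q z := by
  rcases lt_trichotomy z 0 with hz | rfl | hz
  · rw [invQFact_of_neg q hz, invQFact_of_neg q (by omega), mul_zero]
  · rw [invQFact_of_neg q (by omega), zpow_zero, sub_self, zero_mul]
  · obtain ⟨m, rfl⟩ : ∃ m : ℕ, z = m + 1 := ⟨(z - 1).toNat, by omega⟩
    have h := one_sub_zpow_ne_zero hq hz
    rw [add_sub_cancel_right, show ((m : ℤ) + 1) = ((m + 1 : ℕ) : ℤ) by push_cast; rfl,
      invQFact_natCast, invQFact_natCast, Finset.prod_range_succ]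
    rw [show ((m : ℤ) + 1) = ((m + 1 : ℕ) : ℤ) by push_cast; rfl, zpow_natCast] at h
    rw [zpow_natCast, mul_inv]
    field_simp

/-- The summand of the `q`-Vandermonde identity. -/
noncomputable def vandermondeTerm (q : K) (A B k i : ℤ) : K :=
  q ^ ((A - i) * (k - i)) *
    (invQFact q i * invQFact q (A - i) * invQFact q (k - i) * invQFact q (B - k + i))

/-- Termwise q-Pascal rule, from 1 - q^{A+1} = q^i (1 - q^{A+1-i}) + (1 - q^i). -/
theorem vandermondeTerm_succ {q : K} (hq0 : q ≠ 0) (hq : ∀ m : ℕ, 0 < m → q ^ m ≠ 1)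
    (A B k i : ℤ) :
    (1 - q ^ (A + 1)) * vandermondeTerm q (A + 1) B k i =
      q ^ k * vandermondeTerm q A B k i + vandermondeTerm q A B (k - 1) (i - 1) := by
  simp only [vandermondeTerm]
  have h1 := invQFact_sub_one hq i
  have h2 := invQFact_sub_one hq (A + 1 - i)
  have e1 : q ^ (A + 1) = q ^ (A + 1 - i) * q ^ i := by
    rw [← zpow_add₀ hq0]; congr 1; ring
  have e2 : q ^ k * q ^ ((A - i) * (k - i)) = q ^ ((A + 1 - i) * (k - i)) * q ^ i := by
    rw [← zpow_add₀ hq0, ← zpow_add₀ hq0]; congr 1; ring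
  rw [show A + 1 - i - 1 = A - i by ring] at h2
  rw [show A - (i - 1) = A + 1 - i by ring, show k - 1 - (i - 1) = k - i by ring,
    show B - (k - 1) + (i - 1) = B - k + i by ring, h1, ← mul_assoc (q ^ k), e2, h2, e1]
  ring

theorem vandermondeTerm_of_neg (q : K) (A B k : ℤ) {i : ℤ} (hi : i < 0) :
    vandermondeTerm q A B k i = 0 := by
  simp [vandermondeTerm, invQFact_of_neg q hi]

theorem vandermondeTerm_of_lt (q : K) (B k : ℤ) {A i : ℤ} (hi : A < i) :
    vandermondeTerm q A B k i = 0 := by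
  simp [vandermondeTerm, invQFact_of_neg q (sub_neg.mpr hi)]

/-- The `q`-Vandermonde identity. -/
theorem sum_vandermondeTerm {q : K} (hq0 : q ≠ 0) (hq : ∀ m : ℕ, 0 < m → q ^ m ≠ 1)
    (A B : ℕ) (k : ℤ) :
    invQFact q (A + B) * ∑ i ∈ Finset.range (A + 1), vandermondeTerm q A B k i =
      invQFact q k * invQFact q (A + B - k) * invQFact q A * invQFact q B := by
  induction A generalizing k with
  | zero => simp [vandermondeTerm]; ring
  | succ A ih =>
    have h1 : (1 - q ^ ((A : ℤ) + 1)) ≠ 0 := one_sub_zpow_ne_zero hq (by omega)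
    have h2 : (1 - q ^ ((A : ℤ) + B + 1)) ≠ 0 := one_sub_zpow_ne_zero hq (by omega)
    have hs : (1 - q ^ ((A : ℤ) + 1)) *
        ∑ i ∈ Finset.range (A + 1 + 1), vandermondeTerm q ((A : ℤ) + 1) B k i =
        q ^ k * ∑ i ∈ Finset.range (A + 1), vandermondeTerm q A B k i +
          ∑ i ∈ Finset.range (A + 1), vandermondeTerm q A B (k - 1) i := by
      rw [Finset.mul_sum, Finset.sum_congr rfl fun (i : ℕ) _ => vandermondeTerm_succ hq0 hq A B k i,
        Finset.sum_add_distrib, ← Finset.mul_sum, Finset.sum_range_succ _ (A + 1),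
        vandermondeTerm_of_lt q B k (by push_cast; omega), add_zero,
        Finset.sum_range_succ' _ (A + 1), vandermondeTerm_of_neg _ _ _ _ (by simp), add_zero]
      simp
    have f1 := invQFact_sub_one hq ((A : ℤ) + B + 1)
    have f2 := invQFact_sub_one hq ((A : ℤ) + B + 1 - k)
    have f3 := invQFact_sub_one hq k
    have f4 := invQFact_sub_one hq ((A : ℤ) + 1)
    have e : q ^ ((A : ℤ) + B + 1) = q ^ ((A : ℤ) + B + 1 - k) * q ^ k := by
      rw [← zpow_add₀ hq0]; congr 1; ring
    rw [add_sub_cancel_right] at f1 f4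
    rw [show (A : ℤ) + B + 1 - k - 1 = A + B - k by ring] at f2
    have i1 := ih k
    have i2 := ih (k - 1)
    rw [show (A : ℤ) + B - (k - 1) = A + B + 1 - k by ring] at i2
    push_cast
    rw [show (A : ℤ) + 1 + B = A + B + 1 by ring]
    apply mul_left_cancel₀ h1
    apply mul_left_cancel₀ h2
    calc _ = (1 - q ^ ((A : ℤ) + B + 1)) * invQFact q (A + B + 1) *
          ((1 - q ^ ((A : ℤ) + 1)) *
            ∑ i ∈ Finset.range (A + 1 + 1), vandermondeTerm q ((A : ℤ) + 1) B k i) := by ring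
      _ = q ^ k * (invQFact q (A + B) * ∑ i ∈ Finset.range (A + 1), vandermondeTerm q A B k i) +
          invQFact q (A + B) * ∑ i ∈ Finset.range (A + 1), vandermondeTerm q A B (k - 1) i := by
        rw [← f1, hs]; ring
      _ = _ := by
        rw [i1, i2, f2, f3, f4, e]; ring

/-! ### Linearising products of `pairRecip`. -/

/-- `1 / ((q; q)_{n - k} (q; q)_{n + k})`. -/
noncomputable def pairRecip (q : K) (n k : ℤ) : K := invQFact q (n - k) * invQFact q (n + k)

/-- The two possible exponents in the expansion of `pairRecip q n k * pairRecip q m k`. -/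
def weightExp (e : Bool) (n m s : ℤ) : ℤ := if e then s ^ 2 else (n - s) * (m - s)

/-- The coefficients in the expansion of `pairRecip q n k * pairRecip q m k`. -/
noncomputable def expandCoeff (q : K) (e : Bool) (n m s : ℤ) : K :=
  q ^ weightExp e n m s * (invQFact q (n + m) * invQFact q (n - s) * invQFact q (m - s))

theorem sum_range_eq_sum_range_sub {M : Type*} [AddCommMonoid M] (f : ℕ → M) {n k : ℕ}
    (hk : k ≤ n) (hf : ∀ s < k, f s = 0) :
    ∑ s ∈ Finset.range (n + 1), f s = ∑ i ∈ Finset.range (n - k + 1), f (k + i) := by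
  rw [show n + 1 = k + (n - k + 1) by omega, Finset.sum_range_add,
    Finset.sum_eq_zero fun s hs => hf s (Finset.mem_range.mp hs), zero_add]

/-- Both expansions are q-Vandermonde with upper indices n - k and m + k; the lower index is m - k
without the factor q^{k^2} and n + k with it. In the second case the sum is reversed, and s^2 = k^2
+ i(2k+i) for s = k + i produces the weight. -/
theorem pairRecip_mul_pairRecip {q : K} (hq0 : q ≠ 0) (hq : ∀ m : ℕ, 0 < m → q ^ m ≠ 1)
    (e : Bool) {n m k : ℕ} (hk : k ≤ n) :
    q ^ ((e.toNat : ℤ) * (k : ℤ) ^ 2) * (pairRecip q n k * pairRecip q m k) =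
      ∑ s ∈ Finset.range (n + 1), expandCoeff q e n m s * pairRecip q s k := by
  rw [sum_range_eq_sum_range_sub _ hk]
  swap
  · intro s hs
    rw [pairRecip, invQFact_of_neg q (by omega : (s : ℤ) - k < 0)]; ring
  cases e with
  | false =>
    have h := sum_vandermondeTerm hq0 hq (n - k) (m + k) ((m : ℤ) - k)
    rw [Finset.mul_sum] at h
    rw [Nat.cast_sub hk] at h
    push_cast at h
    rw [show (n : ℤ) - k + (m + k) = n + m by ring,
      show (n : ℤ) + m - (m - k) = n + k by ring] at h
    simp only [pairRecip, Bool.toNat_false, Nat.cast_zero, zero_mul, zpow_zero, one_mul]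
    rw [show invQFact q ((n : ℤ) - k) * invQFact q (n + k) *
      (invQFact q ((m : ℤ) - k) * invQFact q (m + k)) = invQFact q ((m : ℤ) - k) *
        invQFact q (n + k) * invQFact q (n - k) * invQFact q (m + k) by ring, ← h]
    refine Finset.sum_congr rfl fun i _ => ?_
    simp only [vandermondeTerm, expandCoeff, weightExp]
    push_cast
    rw [show (m : ℤ) + k - (m - k) + i = k + i + k by ring,
      show (n : ℤ) - k - i = n - (k + i) by ring, show (m : ℤ) - k - i = m - (k + i) by ring,
      show (k : ℤ) + i - k = i by ring]
    ring
  | true =>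
    have h := sum_vandermondeTerm hq0 hq (n - k) (m + k) ((n : ℤ) + k)
    rw [Finset.mul_sum] at h
    rw [Nat.cast_sub hk] at h
    push_cast at h
    rw [show (n : ℤ) - k + (m + k) = n + m by ring,
      show (n : ℤ) + m - (n + k) = m - k by ring] at h
    simp only [pairRecip, Bool.toNat_true, Nat.cast_one, one_mul]
    rw [show invQFact q ((n : ℤ) - k) * invQFact q (n + k) *
      (invQFact q ((m : ℤ) - k) * invQFact q (m + k)) = invQFact q ((n : ℤ) + k) *
        invQFact q (m - k) * invQFact q (n - k) * invQFact q (m + k) by ring, ← h,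
      ← Finset.sum_range_reflect, Finset.mul_sum]
    refine Finset.sum_congr rfl fun i hi => ?_
    have hi' : i ≤ n - k := by simpa [Nat.lt_succ_iff] using hi
    simp only [vandermondeTerm, expandCoeff, weightExp]
    obtain ⟨t, ht⟩ : ∃ t : ℕ, n - k + 1 - 1 - i = t := ⟨_, rfl⟩
    have htn : (t : ℤ) = n - k - i := by omega
    rw [ht, htn]
    push_cast
    rw [show (m : ℤ) + k - (n + k) + (n - k - i) = m - (k + i) by ring,
      show (n : ℤ) - k - (n - k - i) = i by ring,
      show (n : ℤ) + k - (n - k - i) = k + i + k by ring,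
      show (n : ℤ) - k - i = n - (k + i) by ring, show (k : ℤ) + i - k = i by ring]
    rw [show ((k : ℤ) + i) ^ 2 = k ^ 2 + i * (k + i + k) by ring, zpow_add₀ hq0 (k ^ 2)]
    ring

/-! ### Multiplication by κ. -/

/-- `(1 - q ^ k) ^ 2 / q ^ k`. -/
noncomputable def kappa (q : K) (k : ℤ) : K := q ^ k + (q ^ k)⁻¹ - 2

/-- This is (1 - q^{s-k})(1 - q^{s+k}) = (1 - q^s)^2 - q^s κ. -/
theorem kappa_mul_pairRecip {q : K} (hq0 : q ≠ 0) (hq : ∀ m : ℕ, 0 < m → q ^ m ≠ 1) (s k : ℤ) :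
    kappa q k * pairRecip q s k =
      (q ^ s)⁻¹ * ((1 - q ^ s) ^ 2 * pairRecip q s k - pairRecip q (s - 1) k) := by
  have h1 := invQFact_sub_one hq (s - k)
  have h2 := invQFact_sub_one hq (s + k)
  have hs : q ^ s ≠ 0 := zpow_ne_zero _ hq0
  have hk : q ^ k ≠ 0 := zpow_ne_zero _ hq0
  rw [pairRecip, pairRecip, show s - 1 - k = s - k - 1 by ring,
    show s - 1 + k = s + k - 1 by ring, h1, h2, zpow_sub₀ hq0, zpow_add₀ hq0, kappa]
  field_simp
  ring

/-- The factor by which the coefficients in the expansion of `pairRecip q n k * pairRecip q m k`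
change on multiplication with `kappa q k`, with `x = q ^ n`, `y = q ^ m`, `z = q ^ s`. -/
def kappaFactor (e : Bool) (x y z : K) : K :=
  if e then z⁻¹ * ((1 - y) * (1 - z) + (1 - x) * (1 - z) - (1 - x) * (1 - y))
  else x⁻¹ * y⁻¹ * ((1 - y) * (1 - z) - (1 - x) * (1 - y) + y * ((1 - x) * (1 - z)))

theorem expandCoeff_add_one {q : K} (hq0 : q ≠ 0) (hq : ∀ m : ℕ, 0 < m → q ^ m ≠ 1)
    (e : Bool) (n m s : ℤ) :
    (q ^ s)⁻¹ * (1 - q ^ s) ^ 2 * expandCoeff q e n m s -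
        (q ^ (s + 1))⁻¹ * expandCoeff q e n m (s + 1) =
      expandCoeff q e n m s * kappaFactor e (q ^ n) (q ^ m) (q ^ s) := by
  have h1 := invQFact_sub_one hq (n - s)
  have h2 := invQFact_sub_one hq (m - s)
  have hs : q ^ s ≠ 0 := zpow_ne_zero _ hq0
  have hn : q ^ n ≠ 0 := zpow_ne_zero _ hq0
  have hm : q ^ m ≠ 0 := zpow_ne_zero _ hq0
  have hw : q ^ weightExp e n m (s + 1) = q ^ weightExp e n m s *
      (if e then q ^ s * q ^ s * q else q ^ s * q ^ s * q * (q ^ n)⁻¹ * (q ^ m)⁻¹) := by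
    cases e
    · simp only [weightExp, Bool.false_eq_true, if_false, ← zpow_neg]
      nth_rewrite 5 [← zpow_one q]
      simp only [← zpow_add₀ hq0]
      congr 1; ring
    · simp only [weightExp, if_true]
      nth_rewrite 5 [← zpow_one q]
      simp only [← zpow_add₀ hq0]
      congr 1; ring
  simp only [expandCoeff]
  rw [hw, show n - (s + 1) = n - s - 1 by ring, show m - (s + 1) = m - s - 1 by ring, h1, h2,
    zpow_sub₀ hq0, zpow_sub₀ hq0, zpow_add₀ hq0, zpow_one]
  generalize q ^ weightExp e n m s = w
  cases e <;> simp only [kappaFactor, Bool.false_eq_true, if_false, if_true] <;> field_simp <;> ring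

theorem kappa_mul_pairRecip_mul_pairRecip {q : K} (hq0 : q ≠ 0)
    (hq : ∀ m : ℕ, 0 < m → q ^ m ≠ 1) (e : Bool) {n m k : ℕ} (hk : k ≤ n) :
    kappa q k * (q ^ ((e.toNat : ℤ) * (k : ℤ) ^ 2) * (pairRecip q n k * pairRecip q m k)) =
      ∑ s ∈ Finset.range (n + 1), expandCoeff q e n m s *
        kappaFactor e (q ^ (n : ℤ)) (q ^ (m : ℤ)) (q ^ (s : ℤ)) * pairRecip q s k := by
  -- Summation by parts without boundary terms: `pairRecip` vanishes at s = -1, and the coefficient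
  -- vanishes at s = n + 1.
  have hshift : ∑ s ∈ Finset.range (n + 1),
      (q ^ (s : ℤ))⁻¹ * expandCoeff q e n m s * pairRecip q ((s : ℤ) - 1) k =
      ∑ s ∈ Finset.range (n + 1),
        (q ^ ((s : ℤ) + 1))⁻¹ * expandCoeff q e n m ((s : ℤ) + 1) * pairRecip q s k := by
    rw [Finset.sum_range_succ', Finset.sum_range_succ]
    congr 1
    · exact Finset.sum_congr rfl fun s _ => by push_cast; rw [add_sub_cancel_right]
    · rw [pairRecip, invQFact_of_neg q (by omega : ((0 : ℕ) : ℤ) - 1 - k < 0), expandCoeff,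
        expandCoeff, invQFact_of_neg q (by omega : (n : ℤ) - (n + 1) < 0)]
      ring
  rw [pairRecip_mul_pairRecip hq0 hq e hk, Finset.mul_sum]
  calc _ = ∑ s ∈ Finset.range (n + 1),
        ((q ^ (s : ℤ))⁻¹ * (1 - q ^ (s : ℤ)) ^ 2 * expandCoeff q e n m s * pairRecip q s k -
          (q ^ (s : ℤ))⁻¹ * expandCoeff q e n m s * pairRecip q ((s : ℤ) - 1) k) := by
        refine Finset.sum_congr rfl fun s _ => ?_
        rw [mul_left_comm, kappa_mul_pairRecip hq0 hq]
        ring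
    _ = _ := by
        rw [Finset.sum_sub_distrib, hshift, ← Finset.sum_sub_distrib]
        refine Finset.sum_congr rfl fun s _ => ?_
        rw [← expandCoeff_add_one hq0 hq]
        ring

end Generic

/-! ### Gaussian binomials without division. -/

section Gauss

variable {A : Type*} [CommRing A]

/-- The Gaussian binomial coefficients, by the `q`-Pascal rule. -/
def gauss (q : A) : ℕ → ℕ → A
  | _, 0 => 1
  | 0, _ + 1 => 0
  | n + 1, k + 1 => gauss q n k + q ^ (k + 1) * gauss q n (k + 1)

theorem map_gauss {A' : Type*} [CommRing A'] (f : A →+* A') (q : A) (n k : ℕ) :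
    f (gauss q n k) = gauss (f q) n k := by
  induction n generalizing k with
  | zero => cases k <;> simp [gauss]
  | succ n ih => cases k <;> simp [gauss, ih]

theorem gauss_one (n k : ℕ) : gauss (1 : A) n k = n.choose k := by
  induction n generalizing k with
  | zero => cases k <;> simp [gauss]
  | succ n ih => cases k <;> simp [gauss, ih, Nat.choose_succ_succ]

theorem gauss_mem {R : Subring A} {q : A} (hq : q ∈ R) (n k : ℕ) : gauss q n k ∈ R := by
  induction n generalizing k with
  | zero => cases k <;> simp [gauss, R.one_mem, R.zero_mem]
  | succ n ih =>
    cases k with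
    | zero => simp [gauss, R.one_mem]
    | succ k => exact R.add_mem (ih _) (R.mul_mem (R.pow_mem hq _) (ih _))

theorem gauss_of_lt (q : A) {n k : ℕ} (h : n < k) : gauss q n k = 0 := by
  induction n generalizing k with
  | zero => cases k with
    | zero => omega
    | succ k => rfl
  | succ n ih => cases k with
    | zero => omega
    | succ k => rw [gauss, ih (by omega), ih (by omega)]; ring

/-- The source of all integrality: the Pascal recursion stays in any subring containing q, so these
factorial quotients do too. -/
theorem gauss_add {K : Type*} [Field K] {q : K} (hq0 : q ≠ 0) (hq : ∀ m : ℕ, 0 < m → q ^ m ≠ 1)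
    (k l : ℕ) :
    gauss q (k + l) k = invQFact q k * invQFact q l * (invQFact q ((k : ℤ) + l))⁻¹ := by
  obtain ⟨n, hn⟩ : ∃ n, k + l = n := ⟨_, rfl⟩
  induction n generalizing k l with
  | zero =>
    obtain rfl : k = 0 := by omega
    obtain rfl : l = 0 := by omega
    simp [gauss]
  | succ n ih =>
    cases k with
    | zero => simp [gauss, mul_inv_cancel₀ (invQFact_ne_zero hq (Int.natCast_nonneg l))]
    | succ k =>
      have hn' : ((k + 1 : ℕ) : ℤ) + l = n + 1 := by omega
      have h1 := invQFact_sub_one hq ((k : ℤ) + 1)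
      have h2 := invQFact_sub_one hq ((n : ℤ) + 1)
      have h3 := invQFact_ne_zero hq (by omega : (0 : ℤ) ≤ (n : ℤ) + 1)
      have h4 := one_sub_zpow_ne_zero hq (by omega : (0 : ℤ) < (n : ℤ) + 1)
      rw [add_sub_cancel_right] at h1 h2
      have g1 := ih k l (by omega)
      rw [(by omega : k + l = n), (by omega : (k : ℤ) + l = n), h2] at g1
      rw [hn, gauss, hn', g1]
      cases l with
      | zero =>
        obtain rfl : k = n := by omega
        rw [gauss_of_lt q (by omega), h1]
        push_cast
        field_simp
        simp
      | succ l =>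
        have h5 := invQFact_sub_one hq ((l : ℤ) + 1)
        rw [add_sub_cancel_right] at h5
        have g2 := ih (k + 1) l (by omega)
        rw [(by omega : k + 1 + l = n), (by omega : ((k + 1 : ℕ) : ℤ) + l = n), h2] at g2
        have e : q ^ ((n : ℤ) + 1) = q ^ (k + 1) * q ^ ((l : ℤ) + 1) := by
          rw [← zpow_natCast, ← zpow_add₀ hq0]; congr 1; omega
        have e' : q ^ ((k : ℤ) + 1) = q ^ (k + 1) := by
          rw [← zpow_natCast]; push_cast; rfl
        rw [g2]
        push_cast
        rw [h1, h5, e']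
        rw [e] at h4 ⊢
        field_simp
        ring

end Gauss

/-! ### Integrality of the expansion coefficients. -/

section Integrality

variable {K : Type*} [Field K]

theorem zpow_mem_of_inv_mem {R : Subring K} {q : K} (hqR : q ∈ R) (hqR' : q⁻¹ ∈ R) (z : ℤ) :
    q ^ z ∈ R := by
  cases z with
  | ofNat n => simpa using R.pow_mem hqR n
  | negSucc n => simpa [zpow_negSucc] using R.pow_mem hqR' (n + 1)

theorem invQFact_mul_div_mem {R : Subring K} {q : K} (hq0 : q ≠ 0)
    (hq : ∀ m : ℕ, 0 < m → q ^ m ≠ 1) (hqR : q ∈ R) (x y : ℤ) :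
    invQFact q x * invQFact q y * (invQFact q (x + y))⁻¹ ∈ R := by
  rcases lt_or_ge x 0 with hx | hx
  · simp [invQFact_of_neg q hx, R.zero_mem]
  rcases lt_or_ge y 0 with hy | hy
  · simp [invQFact_of_neg q hy, R.zero_mem]
  lift x to ℕ using hx
  lift y to ℕ using hy
  rw [← gauss_add hq0 hq]
  exact gauss_mem hqR _ _

theorem invQFact_mul_mul_div_mem {R : Subring K} {q : K} (hq0 : q ≠ 0)
    (hq : ∀ m : ℕ, 0 < m → q ^ m ≠ 1) (hqR : q ∈ R) (x y z : ℤ) :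
    invQFact q x * invQFact q y * invQFact q z * (invQFact q (x + y + z))⁻¹ ∈ R := by
  rcases lt_or_ge y 0 with hy | hy
  · simp [invQFact_of_neg q hy, R.zero_mem]
  rcases lt_or_ge z 0 with hz | hz
  · simp [invQFact_of_neg q hz, R.zero_mem]
  have h := invQFact_ne_zero hq (add_nonneg hy hz)
  convert R.mul_mem (invQFact_mul_div_mem hq0 hq hqR x (y + z))
    (invQFact_mul_div_mem hq0 hq hqR y z) using 1
  rw [add_assoc]
  field_simp

/-- The `q`-analogue of the Catalan triangle number `k / n * C(2 n, n - k)`. -/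
noncomputable def ballot (q : K) (n k : ℤ) : K :=
  (1 - q ^ k) / (1 - q ^ n) * ((invQFact q (2 * n))⁻¹ * pairRecip q n k)

/-- Rests on (1 - q^{n+k}) - q^k (1 - q^{n-k}) = (1 - q^k)(1 + q^n); a difference of Gaussian
binomials shows integrality despite the denominator 1 - q^n. -/
theorem ballot_eq {q : K} (hq0 : q ≠ 0) (hq : ∀ m : ℕ, 0 < m → q ^ m ≠ 1) {n : ℤ} (hn : 1 ≤ n)
    (k : ℤ) :
    ballot q n k =
      invQFact q (n - k) * invQFact q (n + k - 1) * (invQFact q (2 * n - 1))⁻¹ -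
      q ^ k * (invQFact q (n - k - 1) * invQFact q (n + k) * (invQFact q (2 * n - 1))⁻¹) := by
  have h1 := invQFact_sub_one hq (2 * n)
  have h2 := invQFact_sub_one hq (n - k)
  have h3 := invQFact_sub_one hq (n + k)
  have h4 := one_sub_zpow_ne_zero hq (by omega : 0 < n)
  have h5 := one_sub_zpow_ne_zero hq (by omega : 0 < 2 * n)
  have h6 := invQFact_ne_zero hq (by omega : 0 ≤ 2 * n)
  have hk : q ^ k ≠ 0 := zpow_ne_zero _ hq0
  rw [h1, h2, h3, ballot, pairRecip]
  rw [show q ^ (2 * n) = (q ^ n) ^ 2 by rw [pow_two, ← zpow_add₀ hq0]; congr 1; ring] at h5 ⊢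
  rw [zpow_sub₀ hq0, zpow_add₀ hq0]
  generalize q ^ n = x at *
  field_simp
  ring

theorem ballot_mem {R : Subring K} {q : K} (hq0 : q ≠ 0)
    (hq : ∀ m : ℕ, 0 < m → q ^ m ≠ 1) (hqR : q ∈ R) (hqR' : q⁻¹ ∈ R) {n : ℤ} (hn : 1 ≤ n)
    (k : ℤ) : ballot q n k ∈ R := by
  rw [ballot_eq hq0 hq hn]
  have h1 := invQFact_mul_div_mem hq0 hq hqR (n - k) (n + k - 1)
  have h2 := invQFact_mul_div_mem hq0 hq hqR (n - k - 1) (n + k)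
  rw [show n - k + (n + k - 1) = 2 * n - 1 by ring] at h1
  rw [show n - k - 1 + (n + k) = 2 * n - 1 by ring] at h2
  exact R.sub_mem h1 (R.mul_mem (zpow_mem_of_inv_mem hqR hqR' k) h2)

/-- Every product in `kappaFactor` has two factors among 1-x, 1-y, 1-z, with 1-y and 1-z at most
once each. Hence (1-x)^2 can be divided out by pairing 1-y with u and 1-z with v. -/
theorem kappaFactor_mul_mem {R : Subring K} {x y z u v : K} (e : Bool)
    (hx : x⁻¹ ∈ R) (hy : y ∈ R) (hy' : y⁻¹ ∈ R) (hz : z⁻¹ ∈ R) (hx1 : 1 - x ≠ 0)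
    (hu : u ∈ R) (hv : v ∈ R) (hyu : (1 - y) / (1 - x) * u ∈ R)
    (hzv : (1 - z) / (1 - x) * v ∈ R) :
    kappaFactor e x y z / (1 - x) ^ 2 * (u * v) ∈ R := by
  have h1 := R.mul_mem hyu hzv
  have h2 := R.mul_mem hyu hv
  have h3 := R.mul_mem hu hzv
  cases e
  · convert R.mul_mem (R.mul_mem hx hy') (R.add_mem (R.sub_mem h1 h2) (R.mul_mem hy h3)) using 1
    simp only [kappaFactor, Bool.false_eq_true, if_false]
    field_simp
  · convert R.mul_mem hz (R.sub_mem (R.add_mem h1 h3) h2) using 1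
    simp only [kappaFactor, if_true]
    field_simp

/-- The normalisation by `invQFact q (n - m) ^ 2` is chosen so that the coefficient regroups into
the q-binomials of 2n over n-m and n-s, absorbed by `kappaFactor_mul_mem`, the q-trinomial with
parts n-m, m-s, s-t, and powers of q. -/
theorem step_coeff_mem {R : Subring K} {q : K} (hq0 : q ≠ 0)
    (hq : ∀ m : ℕ, 0 < m → q ^ m ≠ 1) (hqR : q ∈ R) (hqR' : q⁻¹ ∈ R) (e₁ e₂ : Bool)
    {n : ℤ} (hn : 1 ≤ n) (m s t : ℤ) :
    invQFact q (n - m) ^ 2 * ((invQFact q (2 * n))⁻¹ / (1 - q ^ n)) ^ 2 *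
      (expandCoeff q e₁ n m s * kappaFactor e₁ (q ^ n) (q ^ m) (q ^ s) *
        expandCoeff q e₂ n s t) * (invQFact q (n - t) ^ 2)⁻¹ ∈ R := by
  have hz := zpow_mem_of_inv_mem hqR hqR'
  have hz' : ∀ z : ℤ, (q ^ z)⁻¹ ∈ R := fun z => by rw [← zpow_neg]; exact hz _
  have hb : ∀ k, (invQFact q (2 * n))⁻¹ * pairRecip q n k ∈ R := fun k => by
    have := invQFact_mul_div_mem hq0 hq hqR (n - k) (n + k)
    rw [show n - k + (n + k) = 2 * n by ring] at this
    rwa [pairRecip, mul_comm]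
  have h1 := kappaFactor_mul_mem e₁ (hz' n) (hz m) (hz' m) (hz' s)
    (one_sub_zpow_ne_zero hq (by omega)) (hb m) (hb s)
    (ballot_mem hq0 hq hqR hqR' hn m) (ballot_mem hq0 hq hqR hqR' hn s)
  have h2 := invQFact_mul_mul_div_mem hq0 hq hqR (n - m) (m - s) (s - t)
  rw [show n - m + (m - s) + (s - t) = n - t by ring] at h2
  convert R.mul_mem (R.mul_mem (R.mul_mem h1 h2) (hz (weightExp e₁ n m s)))
    (hz (weightExp e₂ n s t)) using 1
  simp only [expandCoeff, pairRecip]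
  -- If n < t, both sides are zero because 0⁻¹ = 0.
  by_cases h : invQFact q (n - t) = 0
  · simp [h]
  · field_simp

theorem exists_step_coeff {R : Subring K} {q : K} (hq0 : q ≠ 0)
    (hq : ∀ m : ℕ, 0 < m → q ^ m ≠ 1) (hqR : q ∈ R) (hqR' : q⁻¹ ∈ R) (e₁ e₂ : Bool)
    {n : ℕ} (hn : 1 ≤ n) (m : ℕ) :
    ∃ c : ℕ → K, (∀ t, c t ∈ R) ∧ ∀ k : ℕ, k ≤ n →
      ((invQFact q (2 * n))⁻¹ / (1 - q ^ (n : ℤ))) ^ 2 *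
        (kappa q k * q ^ (((e₁.toNat : ℤ) + e₂.toNat) * (k : ℤ) ^ 2)) * pairRecip q n k ^ 2 *
        (invQFact q ((n : ℤ) - m) ^ 2 * pairRecip q m k) =
      ∑ t ∈ Finset.range (n + 1), c t * (invQFact q ((n : ℤ) - t) ^ 2 * pairRecip q t k) := by
  refine ⟨fun t => ∑ s ∈ Finset.range (n + 1),
    invQFact q ((n : ℤ) - m) ^ 2 * ((invQFact q (2 * n))⁻¹ / (1 - q ^ (n : ℤ))) ^ 2 *
      (expandCoeff q e₁ n m s * kappaFactor e₁ (q ^ (n : ℤ)) (q ^ (m : ℤ)) (q ^ (s : ℤ)) *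
        expandCoeff q e₂ n s t) * (invQFact q ((n : ℤ) - t) ^ 2)⁻¹,
    fun t => R.sum_mem fun s _ => step_coeff_mem hq0 hq hqR hqR' e₁ e₂ (by omega) _ _ _,
    fun k hk => ?_⟩
  set E := (invQFact q (2 * n))⁻¹ / (1 - q ^ (n : ℤ))
  simp only [Finset.sum_mul]
  rw [Finset.sum_comm, add_mul, zpow_add₀ hq0]
  calc _ = invQFact q ((n : ℤ) - m) ^ 2 * E ^ 2 *
        (q ^ ((e₂.toNat : ℤ) * (k : ℤ) ^ 2) * pairRecip q n k *
          (kappa q k * (q ^ ((e₁.toNat : ℤ) * (k : ℤ) ^ 2) *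
            (pairRecip q n k * pairRecip q m k)))) := by ring
    _ = _ := by
      rw [kappa_mul_pairRecip_mul_pairRecip hq0 hq e₁ hk, Finset.mul_sum, Finset.mul_sum]
      refine Finset.sum_congr rfl fun s _ => ?_
      calc _ = invQFact q ((n : ℤ) - m) ^ 2 * E ^ 2 * (expandCoeff q e₁ n m s *
            kappaFactor e₁ (q ^ (n : ℤ)) (q ^ (m : ℤ)) (q ^ (s : ℤ))) *
            (q ^ ((e₂.toNat : ℤ) * (k : ℤ) ^ 2) * (pairRecip q n k * pairRecip q s k)) := by
            ring
        _ = _ := by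
          rw [pairRecip_mul_pairRecip hq0 hq e₂ hk, Finset.mul_sum]
          refine Finset.sum_congr rfl fun t ht => ?_
          have hF : invQFact q ((n : ℤ) - t) ≠ 0 :=
            invQFact_ne_zero hq (by have := Finset.mem_range.mp ht; omega)
          field_simp

theorem exists_coeff {R : Subring K} {q : K} (hq0 : q ≠ 0)
    (hq : ∀ m : ℕ, 0 < m → q ^ m ≠ 1) (hqR : q ∈ R) (hqR' : q⁻¹ ∈ R)
    {n : ℕ} (hn : 1 ≤ n) (r j : ℕ) (hj : j ≤ 2 * r) :
    ∃ c : ℕ → K, (∀ s, c s ∈ R) ∧ ∀ k : ℕ, k ≤ n →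
      ((invQFact q (2 * n))⁻¹ / (1 - q ^ (n : ℤ))) ^ (2 * r) *
        (kappa q k ^ r * q ^ ((j : ℤ) * (k : ℤ) ^ 2)) * pairRecip q n k ^ (2 * r + 1) =
      ∑ s ∈ Finset.range (n + 1), c s * (invQFact q ((n : ℤ) - s) ^ 2 * pairRecip q s k) := by
  induction r generalizing j with
  | zero =>
    obtain rfl : j = 0 := by omega
    refine ⟨fun s => if s = n then 1 else 0, fun s => ?_, fun k _ => ?_⟩
    · dsimp only
      split_ifs
      exacts [R.one_mem, R.zero_mem]
    · simp
  | succ r ih =>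
    -- Each step uses two product expansions, each absorbing at most one factor q^{k^2}; hence the
    -- bound 2r on j.
    obtain ⟨i, e₁, e₂, hi, rfl⟩ : ∃ (i : ℕ) (e₁ e₂ : Bool), i ≤ 2 * r ∧
        j = i + (e₁.toNat + e₂.toNat) := by
      rcases j with _ | _ | j
      · exact ⟨0, false, false, by omega, rfl⟩
      · exact ⟨0, true, false, by omega, rfl⟩
      · exact ⟨j, true, true, by omega, rfl⟩
    obtain ⟨c, hc, h⟩ := ih i hi
    choose d hd hd' using exists_step_coeff hq0 hq hqR hqR' e₁ e₂ hn
    refine ⟨fun t => ∑ m ∈ Finset.range (n + 1), c m * d m t,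
      fun t => R.sum_mem fun m _ => R.mul_mem (hc m) (hd m t), fun k hk => ?_⟩
    specialize h k hk
    push_cast
    rw [add_mul (i : ℤ), zpow_add₀ hq0]
    set E := (invQFact q (2 * n))⁻¹ / (1 - q ^ (n : ℤ)) with hE
    calc _ = E ^ 2 * (kappa q k * q ^ (((e₁.toNat : ℤ) + e₂.toNat) * (k : ℤ) ^ 2)) *
          pairRecip q n k ^ 2 * (E ^ (2 * r) *
          (kappa q k ^ r * q ^ ((i : ℤ) * (k : ℤ) ^ 2)) * pairRecip q n k ^ (2 * r + 1)) := by
          ring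
      _ = _ := by
        simp only [Finset.sum_mul]
        rw [h, Finset.mul_sum, Finset.sum_comm]
        refine Finset.sum_congr rfl fun m _ => ?_
        rw [mul_left_comm, hd' m k hk, Finset.mul_sum]
        exact Finset.sum_congr rfl fun t _ => by ring

/-! ### Telescoping in k and extraction of the divisor. -/

theorem sum_Icc_sub_add_one {M : Type*} [AddCommGroup M] (g : ℕ → M) {a n : ℕ} (h : a ≤ n) :
    ∑ k ∈ Finset.Icc a n, (g k - g (k + 1)) = g a - g (n + 1) := by
  induction n, h using Nat.le_induction with
  | base => simp
  | succ n h ih => rw [Finset.sum_Icc_succ_top (by omega), ih]; abel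

theorem sum_pairRecip {q : K} (hq0 : q ≠ 0) (hq : ∀ m : ℕ, 0 < m → q ^ m ≠ 1) (e : Bool)
    {n a s : ℕ} (ha : a ≤ n) (hs : s ≤ n) :
    ∑ k ∈ Finset.Icc a n, (1 - q ^ (2 * (k : ℤ))) * (q ^ (k : ℤ))⁻¹ *
      q ^ ((e.toNat : ℤ) * (k : ℤ) ^ 2) * pairRecip q s k =
      q ^ (if e then (a : ℤ) ^ 2 - a else -(s : ℤ)) *
        (invQFact q ((s : ℤ) - a) * invQFact q ((s : ℤ) + a - 1)) := by
  have h := sum_Icc_sub_add_one (fun k : ℕ => q ^ (if e then (k : ℤ) ^ 2 - k else -(s : ℤ)) *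
        (invQFact q ((s : ℤ) - k) * invQFact q ((s : ℤ) + k - 1))) ha
  rw [invQFact_of_neg q (by omega : (s : ℤ) - (n + 1 : ℕ) < 0), zero_mul, mul_zero, sub_zero] at h
  rw [← h]
  refine Finset.sum_congr rfl fun k _ => ?_
  have h1 := invQFact_sub_one hq ((s : ℤ) - k)
  have h2 := invQFact_sub_one hq ((s : ℤ) + k)
  have hk : q ^ (k : ℤ) ≠ 0 := zpow_ne_zero _ hq0
  have hs : q ^ (s : ℤ) ≠ 0 := zpow_ne_zero _ hq0
  push_cast
  rw [show (s : ℤ) - (k + 1) = s - k - 1 by ring, show (s : ℤ) + (k + 1) - 1 = s + k by ring,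
    h1, h2, pairRecip, zpow_sub₀ hq0 s, zpow_add₀ hq0 s,
    show q ^ (2 * (k : ℤ)) = q ^ (k : ℤ) * q ^ (k : ℤ) by rw [← zpow_add₀ hq0]; congr 1; ring]
  cases e
  · simp only [Bool.toNat_false, Nat.cast_zero, zero_mul, zpow_zero, Bool.false_eq_true, if_false,
      zpow_neg]
    field_simp
    ring
  · simp only [Bool.toNat_true, Nat.cast_one, one_mul, if_true]
    rw [show ((k : ℤ) + 1) ^ 2 - (k + 1) = k ^ 2 + k by ring, zpow_add₀ hq0, zpow_sub₀ hq0]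
    field_simp
    ring

theorem exists_sum_ballot_eq {R : Subring K} {q : K} (hq0 : q ≠ 0)
    (hq : ∀ m : ℕ, 0 < m → q ^ m ≠ 1) (hqR : q ∈ R) (hqR' : q⁻¹ ∈ R)
    {n a : ℕ} (ha1 : 1 ≤ a) (ha : a ≤ n) (r j : ℕ) (hj : j ≤ 2 * r + 1) :
    ∃ x ∈ R, ∑ k ∈ Finset.Icc a n, (1 + q ^ k) * ballot q n k ^ (2 * r + 1) *
        q ^ ((j : ℤ) * (k : ℤ) ^ 2 - ((r : ℤ) + 1) * (k : ℤ)) =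
      (1 + q ^ n) * gauss q (2 * n - 1) (n - a) * x := by
  -- The telescoping sum absorbs one further q^{k^2}, raising the bound from 2r to 2r+1.
  obtain ⟨i, e, hi, rfl⟩ : ∃ (i : ℕ) (e : Bool), i ≤ 2 * r ∧ j = i + e.toNat := by
    rcases j with _ | j
    · exact ⟨0, false, by omega, rfl⟩
    · exact ⟨j, true, by omega, rfl⟩
  obtain ⟨c, hc, h⟩ := exists_coeff hq0 hq hqR hqR' (ha1.trans ha) r i hi
  have hg := gauss_add hq0 hq (n - a) (n + a - 1)
  rw [show n - a + (n + a - 1) = 2 * n - 1 by omega,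
    show ((n - a : ℕ) : ℤ) = n - a by omega, show ((n + a - 1 : ℕ) : ℤ) = n + a - 1 by omega,
    show (n : ℤ) - a + (n + a - 1) = 2 * n - 1 by ring] at hg
  refine ⟨∑ s ∈ Finset.range (n + 1), c s * q ^ (if e then (a : ℤ) ^ 2 - a else -(s : ℤ)) *
    ((invQFact q ((n : ℤ) - s) * invQFact q ((s : ℤ) - a) * (invQFact q ((n : ℤ) - a))⁻¹) *
    (invQFact q ((n : ℤ) - s) * invQFact q ((s : ℤ) + a - 1) *
      (invQFact q ((n : ℤ) + a - 1))⁻¹)), R.sum_mem fun s _ => ?_, ?_⟩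
  · have h1 := invQFact_mul_div_mem hq0 hq hqR ((n : ℤ) - s) (s - a)
    have h2 := invQFact_mul_div_mem hq0 hq hqR ((n : ℤ) - s) (s + a - 1)
    rw [show (n : ℤ) - s + (s - a) = n - a by ring] at h1
    rw [show (n : ℤ) - s + (s + a - 1) = n + a - 1 by ring] at h2
    exact R.mul_mem (R.mul_mem (hc s) (zpow_mem_of_inv_mem hqR hqR' _)) (R.mul_mem h1 h2)
  · have hx1 := one_sub_zpow_ne_zero hq (by omega : (0 : ℤ) < n)
    have hterm : ∀ k ∈ Finset.Icc a n, (1 + q ^ k) * ballot q n k ^ (2 * r + 1) *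
        q ^ (((i + e.toNat : ℕ) : ℤ) * (k : ℤ) ^ 2 - ((r : ℤ) + 1) * (k : ℤ)) =
        (invQFact q (2 * n))⁻¹ / (1 - q ^ (n : ℤ)) * ∑ s ∈ Finset.range (n + 1),
          c s * invQFact q ((n : ℤ) - s) ^ 2 * ((1 - q ^ (2 * (k : ℤ))) * (q ^ (k : ℤ))⁻¹ *
      q ^ ((e.toNat : ℤ) * (k : ℤ) ^ 2) * pairRecip q s k) := by
      intro k hk
      have hqk : q ^ (k : ℤ) ≠ 0 := zpow_ne_zero _ hq0
      have hk' := h k (Finset.mem_Icc.mp hk).2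
      -- The weight 1 + q^k and the exponent -(r+1)k are what turn (1-q^k)^{2r+1} into κ^r times the
      -- telescoping factor q^{-k} - q^k.
      have hκ : (1 + q ^ k) * (1 - q ^ (k : ℤ)) ^ (2 * r + 1) *
          q ^ (-(((r : ℤ) + 1) * (k : ℤ))) =
          (1 - q ^ (2 * (k : ℤ))) * (q ^ (k : ℤ))⁻¹ * kappa q k ^ r := by
        have e1 : kappa q k = (1 - q ^ (k : ℤ)) ^ 2 * (q ^ (k : ℤ))⁻¹ := by
          rw [kappa]; field_simp; ring
        have e2 : q ^ (-(((r : ℤ) + 1) * (k : ℤ))) = (q ^ (k : ℤ))⁻¹ ^ (r + 1) := by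
          rw [← zpow_neg, ← zpow_natCast, ← zpow_mul]; congr 1; push_cast; ring
        have e3 : q ^ (2 * (k : ℤ)) = q ^ (k : ℤ) * q ^ (k : ℤ) := by
          rw [← zpow_add₀ hq0]; congr 1; ring
        rw [e1, e2, e3, ← zpow_natCast q k, mul_pow, ← pow_mul]
        ring
      calc _ = ((1 + q ^ k) * (1 - q ^ (k : ℤ)) ^ (2 * r + 1) *
              q ^ (-(((r : ℤ) + 1) * (k : ℤ)))) * q ^ ((e.toNat : ℤ) * (k : ℤ) ^ 2) *
            ((invQFact q (2 * n))⁻¹ / (1 - q ^ (n : ℤ))) ^ (2 * r + 1) *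
            q ^ ((i : ℤ) * (k : ℤ) ^ 2) * pairRecip q n k ^ (2 * r + 1) := by
            rw [ballot, show ((i + e.toNat : ℕ) : ℤ) * (k : ℤ) ^ 2 - ((r : ℤ) + 1) * (k : ℤ) =
              -(((r : ℤ) + 1) * (k : ℤ)) + (e.toNat : ℤ) * (k : ℤ) ^ 2 + (i : ℤ) * (k : ℤ) ^ 2 by
              push_cast; ring, zpow_add₀ hq0, zpow_add₀ hq0]
            simp only [mul_pow, div_pow]
            ring
        _ = (invQFact q (2 * n))⁻¹ / (1 - q ^ (n : ℤ)) * ((1 - q ^ (2 * (k : ℤ))) *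
            (q ^ (k : ℤ))⁻¹ * q ^ ((e.toNat : ℤ) * (k : ℤ) ^ 2)) *
            (((invQFact q (2 * n))⁻¹ / (1 - q ^ (n : ℤ))) ^ (2 * r) *
        (kappa q k ^ r * q ^ ((i : ℤ) * (k : ℤ) ^ 2)) * pairRecip q n k ^ (2 * r + 1)) := by
            rw [hκ, pow_succ _ (2 * r)]
            ring
        _ = _ := by
            rw [hk', Finset.mul_sum, Finset.mul_sum]
            exact Finset.sum_congr rfl fun s _ => by ring
    rw [Finset.sum_congr rfl hterm, ← Finset.mul_sum, Finset.sum_comm, Finset.mul_sum,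
      Finset.mul_sum]
    refine Finset.sum_congr rfl fun s hs => ?_
    have hF := invQFact_sub_one hq (2 * (n : ℤ))
    have h2n := invQFact_ne_zero hq (by omega : (0 : ℤ) ≤ 2 * n)
    have hF1 := invQFact_ne_zero hq (by omega : (0 : ℤ) ≤ n - a)
    have hF2 := invQFact_ne_zero hq (by omega : (0 : ℤ) ≤ n + a - 1)
    have h5 := one_sub_zpow_ne_zero hq (by omega : 0 < 2 * (n : ℤ))
    rw [← Finset.mul_sum, sum_pairRecip hq0 hq e ha (Nat.lt_succ_iff.mp (Finset.mem_range.mp hs)),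
      hg, hF, ← zpow_natCast q n]
    rw [show q ^ (2 * (n : ℤ)) = (q ^ (n : ℤ)) ^ 2 by
      rw [pow_two, ← zpow_add₀ hq0]; congr 1; ring] at h5 ⊢
    generalize q ^ (n : ℤ) = x at *
    field_simp
    ring

end Integrality

/-! ### Transfer to ℚ(q) and ℤ[q, q⁻¹], and the value at q = 1. -/

section Specialization

/-- The ballot numbers `k / n * C(2 n, n - k)` in their integral `q`-form. -/
def ballotGauss {A : Type*} [CommRing A] (q : A) (n k : ℕ) : A :=
  gauss q (2 * n - 1) (n - k) - q ^ k * if k < n then gauss q (2 * n - 1) (n - k - 1) else 0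

theorem map_ballotGauss {A A' : Type*} [CommRing A] [CommRing A'] (f : A →+* A') (q : A)
    (n k : ℕ) : f (ballotGauss q n k) = ballotGauss (f q) n k := by
  unfold ballotGauss
  split_ifs <;> simp [map_gauss]

theorem ballotGauss_one {n k : ℕ} (hn : 1 ≤ n) (hk : k ≤ n) :
    ((ballotGauss (1 : ℤ) n k : ℤ) : ℚ) = B n k := by
  have hn' : (n : ℚ) ≠ 0 := by exact_mod_cast (by omega : n ≠ 0)
  unfold ballotGauss B
  rcases hk.lt_or_eq with hk | rfl
  · obtain ⟨l, rfl⟩ : ∃ l, n = k + l + 1 := ⟨n - k - 1, by omega⟩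
    rw [if_pos (by omega), gauss_one, gauss_one, show k + l + 1 - k - 1 = l by omega,
      show k + l + 1 - k = l + 1 by omega,
      show 2 * (k + l + 1) - 1 = 2 * k + 2 * l + 1 by omega,
      show 2 * (k + l + 1) = 2 * k + 2 * l + 1 + 1 by ring]
    have h1 := Nat.add_one_mul_choose_eq (2 * k + 2 * l + 1) l
    have h2 := Nat.choose_succ_succ (2 * k + 2 * l + 1) l
    rw [Nat.succ_eq_add_one, Nat.succ_eq_add_one] at h2
    rw [h2] at h1 ⊢
    have h1' : (((2 * k + 2 * l + 1 + 1) * (2 * k + 2 * l + 1).choose l : ℕ) : ℚ) =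
      ((((2 * k + 2 * l + 1).choose l + (2 * k + 2 * l + 1).choose (l + 1)) * (l + 1) : ℕ) : ℚ) :=
      congrArg _ h1
    push_cast at h1' hn' ⊢
    field_simp
    linear_combination -h1'
  · simp [gauss, hn']

theorem ballot_eq_ballotGauss {K : Type*} [Field K] {q : K} (hq0 : q ≠ 0)
    (hq : ∀ m : ℕ, 0 < m → q ^ m ≠ 1) {n k : ℕ} (hn : 1 ≤ n) (hk : k ≤ n) :
    ballot q n k = ballotGauss q n k := by
  have h1 := gauss_add hq0 hq (n - k) (n + k - 1)
  rw [show n - k + (n + k - 1) = 2 * n - 1 by omega,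
    show ((n - k : ℕ) : ℤ) = n - k by omega, show ((n + k - 1 : ℕ) : ℤ) = n + k - 1 by omega,
    show (n : ℤ) - k + (n + k - 1) = 2 * n - 1 by ring] at h1
  rw [ballot_eq hq0 hq (by omega), ballotGauss, h1, zpow_natCast]
  split_ifs with hkn
  · have h2 := gauss_add hq0 hq (n - k - 1) (n + k)
    rw [show n - k - 1 + (n + k) = 2 * n - 1 by omega,
      show ((n - k - 1 : ℕ) : ℤ) = n - k - 1 by omega, Nat.cast_add,
      show (n : ℤ) - k - 1 + (n + k) = 2 * n - 1 by ring] at h2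
    rw [h2]
  · rw [invQFact_of_neg q (by omega : (n : ℤ) - k - 1 < 0)]
    ring

theorem q_pow_ne_one (m : ℕ) (hm : 0 < m) : q ^ m ≠ 1 := by
  rw [q, ← RatFunc.algebraMap_X, ← map_pow, ← map_one (algebraMap ℚ[X] (RatFunc ℚ))]
  refine fun h => hm.ne' ?_
  simpa using congrArg Polynomial.natDegree (RatFunc.algebraMap_injective ℚ h)

theorem qShifted_eq (n : ℕ) : qShifted q n = (invQFact q (n : ℤ))⁻¹ := by
  rw [invQFact_natCast, inv_inv, qShifted]
  exact Finset.prod_congr rfl fun i _ => by rw [pow_succ']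

theorem qBinom_eq_gauss {n k : ℕ} (hk : k ≤ n) : qBinom n k = gauss q n k := by
  obtain ⟨l, rfl⟩ := Nat.exists_eq_add_of_le hk
  rw [gauss_add RatFunc.X_ne_zero q_pow_ne_one, qBinom, if_pos hk, qShifted_eq, qShifted_eq,
    qShifted_eq, Nat.add_sub_cancel_left, Nat.cast_add]
  simp only [div_eq_mul_inv, mul_inv, inv_inv]
  ring

theorem qB_eq_ballot {n k : ℕ} (hk : k ≤ n) : qB n k = ballot q n k := by
  have h1 : 1 - q ≠ 0 := sub_ne_zero.mpr (by simpa using (q_pow_ne_one 1 one_pos).symm)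
  rw [qB, qInt, qInt, div_div_div_cancel_right₀ h1, qBinom, if_pos (by omega), qShifted_eq,
    qShifted_eq, qShifted_eq, show 2 * n - (n - k) = n + k by omega, Nat.cast_sub hk, ballot,
    pairRecip, zpow_natCast, zpow_natCast]
  push_cast
  simp only [div_eq_mul_inv, mul_inv, inv_inv]

theorem laurentToRatFunc_T (z : ℤ) : laurentToRatFunc (LaurentPolynomial.T z) = q ^ z := by
  simp [laurentToRatFunc]

theorem laurentToRatFunc_injective : Function.Injective laurentToRatFunc := by
  rw [injective_iff_map_eq_zero]
  intro p hp
  obtain ⟨n, f, hf⟩ := LaurentPolynomial.exists_T_pow p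
  have hhom : laurentToRatFunc.comp (Polynomial.toLaurent (R := ℤ)) =
      (algebraMap ℚ[X] (RatFunc ℚ)).comp (Polynomial.mapRingHom (Int.castRingHom ℚ)) := by
    refine Polynomial.ringHom_ext' (RingHom.ext_int _ _) ?_
    simp [laurentToRatFunc_T]
  have h : algebraMap ℚ[X] (RatFunc ℚ) (f.map (Int.castRingHom ℚ)) = 0 := by
    have := RingHom.congr_fun hhom f
    rw [RingHom.comp_apply, hf, map_mul, hp, zero_mul] at this
    exact this.symm
  rw [map_eq_zero_iff _ (RatFunc.algebraMap_injective ℚ),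
    Polynomial.map_eq_zero_iff (RingHom.injective_int _)] at h
  rw [h, map_zero] at hf
  rw [← mul_one p, ← LaurentPolynomial.T_zero, ← add_neg_cancel (n : ℤ), LaurentPolynomial.T_add,
    ← mul_assoc, ← hf, zero_mul]

theorem exists_sum_qB_eq_of_pos {n a : ℕ} (ha1 : 1 ≤ a) (ha : a ≤ n) (r j : ℕ) (hj : j ≤ 2 * r + 1) :
    ∃ x : ℤ[T;T⁻¹], ∑ k ∈ Finset.Icc a n, (1 + q ^ k) * qB n k ^ (2 * r + 1) *
        q ^ ((j : ℤ) * (k : ℤ) ^ 2 - ((r : ℤ) + 1) * (k : ℤ)) =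
      (1 + q ^ n) * gauss q (2 * n - 1) (n - a) * laurentToRatFunc x := by
  have hqR : q ∈ laurentToRatFunc.range :=
    ⟨LaurentPolynomial.T 1, by rw [laurentToRatFunc_T, zpow_one]⟩
  have hqR' : q⁻¹ ∈ laurentToRatFunc.range :=
    ⟨LaurentPolynomial.T (-1), by rw [laurentToRatFunc_T, zpow_neg_one]⟩
  obtain ⟨_, ⟨x, rfl⟩, hx⟩ :=
    exists_sum_ballot_eq RatFunc.X_ne_zero q_pow_ne_one hqR hqR' ha1 ha r j hj
  refine ⟨x, ?_⟩
  rw [← hx]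
  exact Finset.sum_congr rfl fun k hk => by rw [qB_eq_ballot (Finset.mem_Icc.mp hk).2]

theorem exists_sum_qB_eq {n a : ℕ} (hn : 1 ≤ n) (ha : a ≤ n) (r j : ℕ) (hj : j ≤ 2 * r + 1) :
    ∃ x : ℤ[T;T⁻¹], ∑ k ∈ Finset.Icc a n, (1 + q ^ k) * qB n k ^ (2 * r + 1) *
        q ^ ((j : ℤ) * (k : ℤ) ^ 2 - ((r : ℤ) + 1) * (k : ℤ)) =
      (1 + q ^ n) * gauss q (2 * n - 1) (n - a) * laurentToRatFunc x := by
  rcases a.eq_zero_or_pos with rfl | ha1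
  · obtain ⟨x, hx⟩ := exists_sum_qB_eq_of_pos le_rfl hn r j hj
    refine ⟨x, ?_⟩
    -- The case a = 0 reduces to a = 1: the term k = 0 vanishes since [0] = 0, and the divisors
    -- agree by symmetry.
    have hg : gauss q (2 * n - 1) (n - 0) = gauss q (2 * n - 1) (n - 1) := by
      have h1 := gauss_add RatFunc.X_ne_zero q_pow_ne_one n (n - 1)
      have h2 := gauss_add RatFunc.X_ne_zero q_pow_ne_one (n - 1) n
      rw [show n + (n - 1) = 2 * n - 1 by omega] at h1
      rw [show n - 1 + n = 2 * n - 1 by omega] at h2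
      rw [Nat.sub_zero, h1, h2, add_comm, mul_comm (invQFact _ _)]
    rw [hg, ← hx, ← Nat.range_succ_eq_Icc_zero, Finset.range_eq_Ico,
      Finset.sum_eq_sum_Ico_succ_bot (by omega)]
    simp [qB, qInt, Finset.Ico_add_one_right_eq_Icc]
  · exact exists_sum_qB_eq_of_pos ha1 ha r j hj

/-- Evaluation of Laurent polynomials at `1`. -/
noncomputable def laurentEvalOne : ℤ[T;T⁻¹] →+* ℤ := LaurentPolynomial.eval₂ (RingHom.id ℤ) 1

theorem laurentEvalOne_T (z : ℤ) : laurentEvalOne (LaurentPolynomial.T z) = 1 := by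
  simp [laurentEvalOne]

theorem exists_sum_B_eq {n a : ℕ} (hn : 1 ≤ n) (ha : a ≤ n) (r : ℕ) :
    ∃ z : ℤ, ∑ k ∈ Finset.Icc a n, B n k ^ (2 * r + 1) =
      (z : ℚ) * ((2 * n - 1).choose (n - a) : ℚ) := by
  obtain ⟨x, hx⟩ := exists_sum_qB_eq hn ha r 0 (by omega)
  have hq : laurentToRatFunc (LaurentPolynomial.T 1) = q := by rw [laurentToRatFunc_T, zpow_one]
  -- Evaluation at 1 makes no sense on quotients in ℚ(q), so the identity is first pulled back to
  -- ℤ[T;T⁻¹] with the division-free `ballotGauss`.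
  have hL : ∑ k ∈ Finset.Icc a n, (1 + LaurentPolynomial.T 1 ^ k) *
      ballotGauss (LaurentPolynomial.T 1) n k ^ (2 * r + 1) *
        LaurentPolynomial.T (-(((r : ℤ) + 1) * (k : ℤ))) =
      (1 + LaurentPolynomial.T 1 ^ n) * gauss (LaurentPolynomial.T 1) (2 * n - 1) (n - a) * x := by
    apply laurentToRatFunc_injective
    simp only [map_sum, map_mul, map_add, map_one, map_pow, map_gauss, map_ballotGauss, hq]
    rw [← hx]
    refine Finset.sum_congr rfl fun k hk => ?_
    have hk' := (Finset.mem_Icc.mp hk).2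
    rw [laurentToRatFunc_T, qB_eq_ballot hk',
      ballot_eq_ballotGauss RatFunc.X_ne_zero q_pow_ne_one hn hk']
    simp
  refine ⟨laurentEvalOne x, ?_⟩
  have h1 := congrArg (fun p => ((laurentEvalOne p : ℤ) : ℚ)) hL
  simp only [map_sum, map_mul, map_add, map_one, map_pow, map_gauss, map_ballotGauss,
    laurentEvalOne_T, one_pow, mul_one, gauss_one] at h1
  push_cast at h1
  rw [Finset.sum_congr rfl fun k hk => by
    rw [ballotGauss_one hn (Finset.mem_Icc.mp hk).2], ← Finset.mul_sum] at h1
  -- At q = 1 the factors 1 + q^k and 1 + q^n both become 2 and cancel.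
  linarith

end Specialization

end QCatalan

theorem mainTheorem3 (n a r : ℕ) (hn : 1 ≤ n) (ha : a ≤ n) :
    (∀ j : ℕ, j ≤ 2 * r + 1 →
      QCatalan.LaurentDvd
        ((1 + QCatalan.q ^ n) * QCatalan.qBinom (2 * n - 1) (n - a))
        (∑ k ∈ Finset.Icc a n,
          (1 + QCatalan.q ^ k) * QCatalan.qB n k ^ (2 * r + 1) *
            QCatalan.q ^ ((j : ℤ) * (k : ℤ) ^ 2 - ((r : ℤ) + 1) * (k : ℤ)))) ∧
    (∃ z : ℤ,
      ∑ k ∈ Finset.Icc a n, QCatalan.B n k ^ (2 * r + 1) =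
        (z : ℚ) * ((2 * n - 1).choose (n - a) : ℚ)) := by
  refine ⟨fun j hj => ?_, QCatalan.exists_sum_B_eq hn ha r⟩
  obtain ⟨x, hx⟩ := QCatalan.exists_sum_qB_eq hn ha r j hj
  have hd : QCatalan.laurentToRatFunc (Polynomial.toLaurent
      ((1 + Polynomial.X ^ n) * QCatalan.gauss Polynomial.X (2 * n - 1) (n - a) : ℤ[X])) =
      (1 + QCatalan.q ^ n) * QCatalan.qBinom (2 * n - 1) (n - a) := by
    rw [QCatalan.qBinom_eq_gauss (by omega)]
    simp [QCatalan.map_gauss, QCatalan.laurentToRatFunc_T]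
  refine ⟨_, _ * x, hd, ?_, dvd_mul_right _ _⟩
  rw [map_mul, hd, hx, QCatalan.qBinom_eq_gauss (by omega)]
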